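/- **Theorem 6.** For $\mathbf x=(x,y)^\top\in\mathbb R^2$ write $x=r\cos\theta$, $y=r\sin\theta$, $r=\sqrt{x^2+y^2}$, let $\rho(\theta)=\begin{pmatrix}\cos\theta&-\sin\theta\\ \sin\theta&\cos\theta\end{pmatrix}$, and let $P_n^{(a,b)}$ be the Jacobi polynomials in the standard normalisation $P_n^{(a,b)}(1)=\frac{(a+1)_n}{n!}$, where $(c)_n=c(c+1)\cdots(c+n-1)$. For $m\in\mathbb Z$ and $j\ge 0$ let $$w_{mj}(\mathbf x)=(1-r^2)\,P_j^{(1,|m|)}(2r^2-1)\,(x+i\,\mathrm{sign}(m)\,y)^{|m|}$$ be the weighted generalised Zernike polynomials. For $n\ge 0$ and real $b\ge 0$ put $$\mathfrak r_n^{(b)}=10n^2+n(13b+19)+4(b+1)(b+2),$$ $$\mathbf v_n^{(b)}(t)=\begin{pmatrix}(b+1)(1-t)P_n^{(1,b+1)}(2t-1)-2t(n+1)P_n^{(0,b+2)}(2t-1)\\ (b+1)P_n^{(1,b+1)}(2t-1)\end{pmatrix},$$ $$\mathbf q_n^{(b),1}(t)=\frac{2n+b+1}{(n+1)\mathfrak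 r_n^{(b)}}\left[(2n+b+2)(2n+b+3)P_n^{(1,b)}(2t-1)\begin{pmatrix}1-t\\1\end{pmatrix}-(n+b+2)\mathbf v_n^{(b)}(t)\right],$$ $$\mathbf q_n^{(b),2}(t)=-\tfrac1n\mathbf v_{n-1}^{(b)}(t)-\mathbf q_n^{(b),1}(t)\quad(n\ge1).$$ For $j\ge1$ define $$\mathbf v_{0j}^{N,1}=P_{j-1}^{(0,1)}(2r^2-1)\begin{pmatrix}x\\y\end{pmatrix},\qquad \mathbf v_{0j}^{N,2}=P_{j-1}^{(1,1)}(2r^2-1)\begin{pmatrix}-y\\x\end{pmatrix},$$ and, for $m\ne0$ and $\nu=1,2$, $$\mathbf v_{mj}^{N,\nu}=r^{|m|-1}e^{im\theta}\rho(\theta)\begin{pmatrix}1&0\\0&i\,\mathrm{sign}(m)\end{pmatrix}\mathbf q_j^{(|m|-1),\nu}(r^2).$$ With $N(x,y)=\begin{pmatrix}1-y^2&xy\\xy&1-x^2\end{pmatrix}$ put $\mathbf n_{mj}^{\nu}=N\,\mathbf v_{mj}^{N,\nu}$, and let $\mathbf n_{0j}^+=2\mathbf n_{0j}^1$ and $\mathbf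 n_{mj}^+=\mathbf n_{mj}^1+\mathbf n_{mj}^2$ for $m\neq0$. Then for all $m\in\mathbb Z$ and all $j\ge0$, at every point of $\mathbb R^2$ (in particular on the closed unit disk), $$\nabla w_{mj}=-(j+1)\,\mathbf n_{m,j+1}^+ ,\qquad \nabla=(\partial_x,\partial_y)^\top .$$ -/

import Mathlib

namespace DiskZernike

noncomputable section

/-- The real plane, with its Euclidean norm; `p 0 = x`, `p 1 = y` and `‖p‖ = r`. -/
abbrev Plane : Type := EuclideanSpace ℝ (Fin 2)

/-- The Jacobi polynomial
`P_n^{(a,b)}(x) = ∑_{l=0}^n (n+a+b+1)_l (a+l+1)_{n-l} / (l! (n-l)!) * ((x-1)/2)^l`,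
with `(c)_l` the rising factorial (the standard normalisation, `P_n^{(a,b)}(1) = (a+1)_n / n!`). -/
def jacobiP (n : ℕ) (a b : ℝ) : Polynomial ℝ :=
  ∑ l ∈ Finset.range (n + 1),
    Polynomial.C ((ascPochhammer ℝ l).eval (n + a + b + 1) *
        (ascPochhammer ℝ (n - l)).eval (a + l + 1) / (l.factorial * (n - l).factorial)) *
      (Polynomial.C (1 / 2) * (Polynomial.X - 1)) ^ l

/-- `P_n^{(a,b)}(2t-1)`. -/
def shiftedJacobi (n : ℕ) (a b t : ℝ) : ℝ :=
  (jacobiP n a b).eval (2 * t - 1)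

/-- `sign m` as a complex number. -/
def sgn (m : ℤ) : ℂ := (m.sign : ℂ)

/-- The harmonic polynomial `y_m = (x + sign(m) i y)^{|m|}`. -/
def harmonicY (m : ℤ) (p : Plane) : ℂ :=
  ((p 0 : ℂ) + sgn m * Complex.I * (p 1 : ℂ)) ^ m.natAbs

/-- The generalised Zernike polynomial `z_{mj}^{(lam)} = P_j^{(lam,|m|)}(2r²-1) y_m`. -/
def zernike (lam : ℝ) (m : ℤ) (j : ℕ) (p : Plane) : ℂ :=
  (shiftedJacobi j lam m.natAbs (‖p‖ ^ 2) : ℂ) * harmonicY m p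

/-- The weighted Zernike polynomial `w_{mj} = (1-r²) z_{mj}^{(1)}`. -/
def weightedZernike (m : ℤ) (j : ℕ) (p : Plane) : ℂ :=
  (1 - (‖p‖ : ℂ) ^ 2) * zernike 1 m j p

/-- The gradient `(∂_x f, ∂_y f)` of a complex-valued function on the plane. -/
def gradC (f : Plane → ℂ) (p : Plane) : Fin 2 → ℂ :=
  fun i => fderiv ℝ f p (EuclideanSpace.single i 1)

/-- The constant `𝔯_n^{(b)} = 10n² + n(13b+19) + 4(b+1)(b+2)`. -/
def rConst (n : ℕ) (b : ℝ) : ℝ :=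
  10 * (n : ℝ) ^ 2 + n * (13 * b + 19) + 4 * (b + 1) * (b + 2)

/-- The univariate vector polynomial `v_n^{(b)}(t)`. -/
def vAux (n : ℕ) (b t : ℝ) : Fin 2 → ℝ :=
  ![(b + 1) * (1 - t) * shiftedJacobi n 1 (b + 1) t
      - 2 * t * (n + 1) * shiftedJacobi n 0 (b + 2) t,
    (b + 1) * shiftedJacobi n 1 (b + 1) t]

/-- The univariate vector polynomial `q_n^{(b),1}(t)`. -/
def qOne (n : ℕ) (b t : ℝ) : Fin 2 → ℝ :=
  ((2 * n + b + 1) / ((n + 1) * rConst n b)) •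
    (((2 * n + b + 2) * (2 * n + b + 3) * shiftedJacobi n 1 b t) • ![1 - t, 1]
      - (n + b + 2) • vAux n b t)

/-- The univariate vector polynomial `q_n^{(b),2}(t)` for `n ≥ 1`; by convention
`q_0^{(b),2} = 0`. -/
def qTwo : (n : ℕ) → (b t : ℝ) → Fin 2 → ℝ
  | 0, _, _ => 0
  | n + 1, b, t => -((1 / ((n + 1 : ℕ) : ℝ)) • vAux n b t) - qOne (n + 1) b t

/-- The polar angle `θ` of a point (the value at the origin, where it is immaterial, is `0`). -/
def polarAngle (p : Plane) : ℝ :=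
  Complex.arg (⟨p 0, p 1⟩ : ℂ)

/-- The rotation matrix `ρ(φ)`. -/
def rot (φ : ℝ) : Matrix (Fin 2) (Fin 2) ℂ :=
  !![(Real.cos φ : ℂ), -(Real.sin φ : ℂ); (Real.sin φ : ℂ), (Real.cos φ : ℂ)]

/-- For `m ≠ 0`, the map
`𝒫_m f = r^{|m|-1} e^{imθ} ρ(θ) diag(1, i sign m) f(r²)` from univariate vector polynomials to
vector functions on the plane. -/
def liftMode (m : ℤ) (f : ℝ → Fin 2 → ℝ) (p : Plane) : Fin 2 → ℂ :=
  ((‖p‖ : ℂ) ^ (m.natAbs - 1) * Complex.exp (Complex.I * m * polarAngle p)) •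
    (rot (polarAngle p)).mulVec
      ((Matrix.diagonal ![1, Complex.I * sgn m]).mulVec
        (fun i => ((f (‖p‖ ^ 2) i : ℝ) : ℂ)))

/-- The vector field `r e_r = (x, y)`. -/
def rER (p : Plane) : Fin 2 → ℂ := ![(p 0 : ℂ), (p 1 : ℂ)]

/-- The vector field `r e_θ = (-y, x)`. -/
def rETheta (p : Plane) : Fin 2 → ℂ := ![-(p 1 : ℂ), (p 0 : ℂ)]

/-- The vector orthogonal polynomial `v_{mj}^{N,1}`; for `m = 0` it is meant for `j ≥ 1`. -/
def vNOne (m : ℤ) (j : ℕ) (p : Plane) : Fin 2 → ℂ :=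
  if m = 0 then (shiftedJacobi (j - 1) 0 1 (‖p‖ ^ 2) : ℂ) • rER p
  else liftMode m (qOne j ((m.natAbs : ℝ) - 1)) p

/-- The vector orthogonal polynomial `v_{mj}^{N,2}`, meant for `j ≥ 1`. -/
def vNTwo (m : ℤ) (j : ℕ) (p : Plane) : Fin 2 → ℂ :=
  if m = 0 then (shiftedJacobi (j - 1) 1 1 (‖p‖ ^ 2) : ℂ) • rETheta p
  else liftMode m (qTwo j ((m.natAbs : ℝ) - 1)) p

/-- The matrix weight `N(x,y)`, which makes vectors normal at the unit circle. -/
def weightN (p : Plane) : Matrix (Fin 2) (Fin 2) ℂ :=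
  !![1 - (p 1 : ℂ) ^ 2, (p 0 : ℂ) * (p 1 : ℂ);
     (p 0 : ℂ) * (p 1 : ℂ), 1 - (p 0 : ℂ) ^ 2]

/-- `n_{mj}^1 = N v_{mj}^{N,1}`. -/
def nOne (m : ℤ) (j : ℕ) (p : Plane) : Fin 2 → ℂ :=
  (weightN p).mulVec (vNOne m j p)

/-- `n_{mj}^2 = N v_{mj}^{N,2}`. -/
def nTwo (m : ℤ) (j : ℕ) (p : Plane) : Fin 2 → ℂ :=
  (weightN p).mulVec (vNTwo m j p)

/-- For `j ≥ 1`: `n_{0j}^+ = 2 n_{0j}^1`, and `n_{mj}^+ = n_{mj}^1 + n_{mj}^2` for `m ≠ 0`. -/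
def nPlus (m : ℤ) (j : ℕ) (p : Plane) : Fin 2 → ℂ :=
  if m = 0 then (2 : ℂ) • nOne m j p else nOne m j p + nTwo m j p

end

end DiskZernike

/-!
In the variable `u = x - 1`, the operator `a + u d/du` multiplies the `l`-th term of `P_n^{(a,b)}`
by `a + l`, which turns the polynomial into `(n + a) P_n^{(a-1,b+1)}`. Hence
`d/dt [(1-t) P_n^{(1,b)}(2t-1)] = -(n+1) P_n^{(0,b+1)}(2t-1)`, and with `ζ = x + i sign(m) y` the
product rule gives
`∇w_{mj} = (1-r²) P_j^{(1,|m|)} |m| ζ^{|m|-1} (1, i sign m) - 2(j+1) P_j^{(0,|m|+1)} ζ^{|m|} (x,y)`.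

On the other side, for `m ≠ 0`, `𝐯_{m,j+1}^{N,1} + 𝐯_{m,j+1}^{N,2}` is a multiple of the lift of
`𝐯_j^{(|m|-1)}`, because `𝐪^1` cancels against its negative in the definition of `𝐪^2`. The weight
`N` fixes `e_r` and multiplies `e_θ` by `1-r²`. The two terms of the gradient now appear because
`e_r + i sign(m) e_θ = e^{-i sign(m) θ} (1, i sign m)`, where the exponential lowers the power of
`ζ` by one.
-/

namespace DiskZernike

section Jacobi

open Polynomial

theorem mul_ascPochhammer_eval_add_one {S : Type*} [CommSemiring S] (k : ℕ) (x : S) :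
    x * (ascPochhammer S k).eval (x + 1) = (x + k) * (ascPochhammer S k).eval x := by
  calc x * (ascPochhammer S k).eval (x + 1) = (ascPochhammer S (k + 1)).eval x := by
        simp [ascPochhammer_succ_left, eval_comp]
    _ = (x + k) * (ascPochhammer S k).eval x := by
        rw [ascPochhammer_succ_eval, mul_comm]

theorem X_sub_one_mul_derivative_pow {R : Type*} [CommRing R] (c : R) (l : ℕ) :
    (X - 1) * derivative ((C c * (X - 1)) ^ l) = C (l : R) * (C c * (X - 1)) ^ l := by
  cases l with
  | zero => simp
  | succ l =>
    simp only [derivative_pow_succ, derivative_C_mul, derivative_sub, derivative_X, derivative_one,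
      Nat.cast_succ]
    ring

theorem C_add_mul_jacobiP_sub_one_add_one (n : ℕ) (a b : ℝ) :
    C (n + a) * jacobiP n (a - 1) (b + 1) =
      C a * jacobiP n a b + (X - 1) * derivative (jacobiP n a b) := by
  simp only [jacobiP, derivative_sum, Finset.mul_sum, ← Finset.sum_add_distrib]
  refine Finset.sum_congr rfl fun l hl ↦ ?_
  have hln : l ≤ n := Nat.lt_succ_iff.mp (Finset.mem_range.mp hl)
  have hpoch : (a + l) * (ascPochhammer ℝ (n - l)).eval (a + l + 1) =
      (n + a) * (ascPochhammer ℝ (n - l)).eval (a + l) := by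
    rw [mul_ascPochhammer_eval_add_one, Nat.cast_sub hln]
    ring
  rw [derivative_C_mul, mul_left_comm (X - 1), X_sub_one_mul_derivative_pow,
    show (n + (a - 1) + (b + 1) + 1 : ℝ) = n + a + b + 1 by ring,
    show a - 1 + l + 1 = a + l by ring]
  set c := (ascPochhammer ℝ l).eval (n + a + b + 1) / (l.factorial * (n - l).factorial)
  calc _ = C (c * ((n + a) * (ascPochhammer ℝ (n - l)).eval (a + l))) *
          (C (1 / 2) * (X - 1)) ^ l := by
        rw [← mul_assoc, ← C_mul]
        congr 2
        ring
    _ = C (c * ((a + l) * (ascPochhammer ℝ (n - l)).eval (a + l + 1))) *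
          (C (1 / 2) * (X - 1)) ^ l := by rw [hpoch]
    _ = _ := by
        rw [mul_div_right_comm]
        simp only [C_mul, C_add]
        ring

theorem hasDerivAt_one_sub_pow_mul_shiftedJacobi (n k : ℕ) (b t : ℝ) :
    HasDerivAt (fun t ↦ (1 - t) ^ (k + 1) * shiftedJacobi n (k + 1) b t)
      (-((n + k + 1) * (1 - t) ^ k * shiftedJacobi n k (b + 1) t)) t := by
  have hraise := congrArg (eval (2 * t - 1)) (C_add_mul_jacobiP_sub_one_add_one n (k + 1) b)
  simp only [eval_mul, eval_add, eval_sub, eval_C, eval_X, eval_one, add_sub_cancel_right]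
    at hraise
  have hweight := ((hasDerivAt_id t).const_sub 1).fun_pow (k + 1)
  have hjacobi := ((jacobiP n (k + 1) b).hasDerivAt (2 * t - 1)).comp t
    (((hasDerivAt_id t).const_mul 2).sub_const 1)
  refine (hweight.fun_mul hjacobi).congr_deriv ?_
  simp only [id, Function.comp_apply, Nat.add_sub_cancel, Nat.cast_add, Nat.cast_one]
  rw [shiftedJacobi]
  linear_combination (1 - t) ^ k * hraise

theorem hasDerivAt_one_sub_mul_shiftedJacobi (n : ℕ) (b t : ℝ) :
    HasDerivAt (fun t ↦ (1 - t) * shiftedJacobi n 1 b t)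
      (-((n + 1) * shiftedJacobi n 0 (b + 1) t)) t := by
  simpa using hasDerivAt_one_sub_pow_mul_shiftedJacobi n 0 b t

end Jacobi

section Gradient

variable {p : Plane}

theorem gradC_mul {f g : Plane → ℂ} (hf : DifferentiableAt ℝ f p) (hg : DifferentiableAt ℝ g p) :
    gradC (fun q ↦ f q * g q) p = f p • gradC g p + g p • gradC f p := by
  ext i
  simp [gradC, fderiv_fun_mul hf hg]

theorem gradC_pow {f : Plane → ℂ} (hf : DifferentiableAt ℝ f p) (n : ℕ) :
    gradC (fun q ↦ f q ^ n) p = (n * f p ^ (n - 1)) • gradC f p := by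
  ext i
  simp [gradC, fderiv_fun_pow n hf]

theorem hasFDerivAt_ofReal_comp_norm_sq {E : Type*} [NormedAddCommGroup E]
    [InnerProductSpace ℝ E] {f : ℝ → ℝ} {f' : ℝ} {x : E} (hf : HasDerivAt f f' (‖x‖ ^ 2)) :
    HasFDerivAt (fun y : E ↦ (f (‖y‖ ^ 2) : ℂ))
      (Complex.ofRealCLM.comp (f' • 2 • innerSL ℝ x)) x :=
  Complex.ofRealCLM.hasFDerivAt.comp x
    (hf.comp_hasFDerivAt x (hasStrictFDerivAt_norm_sq x).hasFDerivAt)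

theorem gradC_ofReal_comp_norm_sq {f : ℝ → ℝ} {f' : ℝ} (hf : HasDerivAt f f' (‖p‖ ^ 2)) :
    gradC (fun q ↦ (f (‖q‖ ^ 2) : ℂ)) p = (2 * f' : ℂ) • rER p := by
  ext i
  rw [gradC, (hasFDerivAt_ofReal_comp_norm_sq hf).fderiv]
  fin_cases i <;> simp [rER, EuclideanSpace.inner_single_right] <;> ring

/-- The complex coordinate `ζ = x + i sign(m) y`, of which `harmonicY m` is the `|m|`-th power. -/
noncomputable def signedCoord (m : ℤ) (p : Plane) : ℂ :=
  p 0 + sgn m * Complex.I * p 1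

theorem harmonicY_eq_signedCoord_pow (m : ℤ) (p : Plane) :
    harmonicY m p = signedCoord m p ^ m.natAbs := rfl

theorem hasFDerivAt_signedCoord (m : ℤ) (p : Plane) :
    HasFDerivAt (signedCoord m)
      (Complex.ofRealCLM.comp (EuclideanSpace.proj 0) +
        (sgn m * Complex.I) • Complex.ofRealCLM.comp (EuclideanSpace.proj 1)) p :=
  (Complex.ofRealCLM.comp (EuclideanSpace.proj 0) +
    (sgn m * Complex.I) • Complex.ofRealCLM.comp (EuclideanSpace.proj 1) :
      Plane →L[ℝ] ℂ).hasFDerivAt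

theorem gradC_signedCoord (m : ℤ) (p : Plane) :
    gradC (signedCoord m) p = ![1, sgn m * Complex.I] := by
  ext i
  rw [gradC, (hasFDerivAt_signedCoord m p).fderiv]
  fin_cases i <;> simp

theorem differentiable_harmonicY (m : ℤ) : Differentiable ℝ (harmonicY m) :=
  fun p ↦ (hasFDerivAt_signedCoord m p).differentiableAt.pow m.natAbs

theorem gradC_harmonicY (m : ℤ) (p : Plane) :
    gradC (harmonicY m) p =
      (m.natAbs * signedCoord m p ^ (m.natAbs - 1)) • ![1, sgn m * Complex.I] := by
  rw [← gradC_signedCoord m p]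
  exact gradC_pow (hasFDerivAt_signedCoord m p).differentiableAt m.natAbs

theorem weightedZernike_eq_ofReal_mul_harmonicY (m : ℤ) (j : ℕ) :
    weightedZernike m j = fun p ↦
      (((1 - ‖p‖ ^ 2) * shiftedJacobi j 1 m.natAbs (‖p‖ ^ 2) : ℝ) : ℂ) * harmonicY m p := by
  ext p
  simp only [weightedZernike, zernike]
  push_cast
  ring

theorem differentiable_weightedZernike (m : ℤ) (j : ℕ) :
    Differentiable ℝ (weightedZernike m j) := by
  rw [weightedZernike_eq_ofReal_mul_harmonicY]
  exact fun p ↦ (hasFDerivAt_ofReal_comp_norm_sq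
    (hasDerivAt_one_sub_mul_shiftedJacobi j m.natAbs _)).differentiableAt.mul
      (differentiable_harmonicY m p)

theorem gradC_weightedZernike (m : ℤ) (j : ℕ) (p : Plane) :
    gradC (weightedZernike m j) p =
      ((1 - (‖p‖ : ℂ) ^ 2) * (m.natAbs * shiftedJacobi j 1 m.natAbs (‖p‖ ^ 2)) *
          signedCoord m p ^ (m.natAbs - 1)) • ![1, sgn m * Complex.I] -
        (2 * (j + 1) * shiftedJacobi j 0 (m.natAbs + 1) (‖p‖ ^ 2) * harmonicY m p) • rER p := by
  have hradial := hasDerivAt_one_sub_mul_shiftedJacobi j m.natAbs (‖p‖ ^ 2)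
  rw [weightedZernike_eq_ofReal_mul_harmonicY,
    gradC_mul (hasFDerivAt_ofReal_comp_norm_sq hradial).differentiableAt
      (differentiable_harmonicY m p),
    gradC_ofReal_comp_norm_sq hradial, gradC_harmonicY]
  push_cast
  module

end Gradient

section PolarFrame

open Matrix

/-- The radial unit vector `e_r` at angle `φ`, with complex entries. -/
noncomputable def eR (φ : ℝ) : Fin 2 → ℂ := ![(Real.cos φ : ℂ), (Real.sin φ : ℂ)]

/-- The angular unit vector `e_θ` at angle `φ`, with complex entries. -/
noncomputable def eTheta (φ : ℝ) : Fin 2 → ℂ := ![-(Real.sin φ : ℂ), (Real.cos φ : ℂ)]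

theorem eR_dotProduct_eR (φ : ℝ) : eR φ ⬝ᵥ eR φ = 1 := by
  simp only [eR, vec2_dotProduct, cons_val_zero, cons_val_one]
  exact_mod_cast (by linear_combination Real.cos_sq_add_sin_sq φ :
    Real.cos φ * Real.cos φ + Real.sin φ * Real.sin φ = 1)

theorem eR_dotProduct_eTheta (φ : ℝ) : eR φ ⬝ᵥ eTheta φ = 0 := by
  simp only [eR, eTheta, vec2_dotProduct, cons_val_zero, cons_val_one]
  ring

theorem rER_eq_norm_smul_eR (p : Plane) : rER p = (‖p‖ : ℂ) • eR (polarAngle p) := by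
  have hnorm : ‖p‖ = ‖(⟨p 0, p 1⟩ : ℂ)‖ := by
    rw [EuclideanSpace.norm_eq, Complex.norm_eq_sqrt_sq_add_sq]
    simp
  ext i
  fin_cases i <;> simp only [rER, eR, polarAngle, hnorm, Fin.zero_eta, Fin.mk_one, Pi.smul_apply,
    cons_val_zero, cons_val_one, smul_eq_mul, ← Complex.ofReal_mul, Complex.norm_mul_cos_arg,
    Complex.norm_mul_sin_arg]

theorem rER_dotProduct_rER (p : Plane) : rER p ⬝ᵥ rER p = (‖p‖ : ℂ) ^ 2 := by
  simp only [rER_eq_norm_smul_eR, smul_dotProduct, dotProduct_smul, eR_dotProduct_eR, smul_eq_mul]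
  ring

theorem weightN_mulVec (p : Plane) (v : Fin 2 → ℂ) :
    weightN p *ᵥ v = (1 - (‖p‖ : ℂ) ^ 2) • v + (rER p ⬝ᵥ v) • rER p := by
  rw [← rER_dotProduct_rER]
  ext i
  fin_cases i <;> simp [weightN, rER, mulVec, vecHead, vecTail] <;> ring

theorem weightN_mulVec_rER (p : Plane) : weightN p *ᵥ rER p = rER p := by
  rw [weightN_mulVec, rER_dotProduct_rER]
  module

theorem weightN_mulVec_eR (p : Plane) :
    weightN p *ᵥ eR (polarAngle p) = eR (polarAngle p) := by
  rw [weightN_mulVec, rER_eq_norm_smul_eR, smul_dotProduct, eR_dotProduct_eR]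
  module

theorem weightN_mulVec_eTheta (p : Plane) :
    weightN p *ᵥ eTheta (polarAngle p) = (1 - (‖p‖ : ℂ) ^ 2) • eTheta (polarAngle p) := by
  rw [weightN_mulVec, rER_eq_norm_smul_eR, smul_dotProduct, eR_dotProduct_eTheta]
  module

theorem liftMode_eq_smul_eR_add_eTheta (m : ℤ) (f : ℝ → Fin 2 → ℝ) (p : Plane) :
    liftMode m f p =
      ((‖p‖ : ℂ) ^ (m.natAbs - 1) * Complex.exp (Complex.I * m * polarAngle p)) •
        ((f (‖p‖ ^ 2) 0 : ℂ) • eR (polarAngle p) +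
          (sgn m * Complex.I * f (‖p‖ ^ 2) 1) • eTheta (polarAngle p)) := by
  rw [liftMode]
  congr 1
  ext i
  fin_cases i <;> simp [rot, eR, eTheta, mulVec] <;> ring

theorem weightN_mulVec_liftMode (m : ℤ) (f : ℝ → Fin 2 → ℝ) (p : Plane) :
    weightN p *ᵥ liftMode m f p =
      ((‖p‖ : ℂ) ^ (m.natAbs - 1) * Complex.exp (Complex.I * m * polarAngle p)) •
        ((f (‖p‖ ^ 2) 0 : ℂ) • eR (polarAngle p) +
          ((1 - (‖p‖ : ℂ) ^ 2) * (sgn m * Complex.I * f (‖p‖ ^ 2) 1)) •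
            eTheta (polarAngle p)) := by
  simp only [liftMode_eq_smul_eR_add_eTheta, mulVec_smul, mulVec_add, weightN_mulVec_eR,
    weightN_mulVec_eTheta]
  module

end PolarFrame

section Modes

open Matrix

variable {m : ℤ}

theorem sgn_eq_one_or_neg_one (hm : m ≠ 0) : sgn m = 1 ∨ sgn m = -1 := by
  rcases lt_or_gt_of_ne hm with hneg | hpos
  · simp [sgn, Int.sign_eq_neg_one_of_neg hneg]
  · simp [sgn, Int.sign_eq_one_of_pos hpos]

theorem sgn_mul_natAbs (m : ℤ) : sgn m * m.natAbs = m := by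
  rw [sgn, ← Int.cast_natCast, ← Int.cast_mul, Int.sign_mul_natAbs]

theorem exp_sgn_mul_mul_I (hm : m ≠ 0) (z : ℂ) :
    Complex.exp (sgn m * z * Complex.I) =
      Complex.cos z + sgn m * Complex.I * Complex.sin z := by
  rcases sgn_eq_one_or_neg_one hm with h | h <;> simp only [h, one_mul, neg_one_mul,
    Complex.exp_mul_I, Complex.cos_neg, Complex.sin_neg] <;> ring

theorem signedCoord_eq_norm_mul_exp (hm : m ≠ 0) (p : Plane) :
    signedCoord m p = ‖p‖ * Complex.exp (sgn m * polarAngle p * Complex.I) := by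
  have hx := congrFun (rER_eq_norm_smul_eR p) 0
  have hy := congrFun (rER_eq_norm_smul_eR p) 1
  simp only [rER, eR, Pi.smul_apply, cons_val_zero, cons_val_one, smul_eq_mul] at hx hy
  rw [signedCoord, hx, hy, exp_sgn_mul_mul_I hm]
  push_cast
  ring

theorem exp_I_mul_eq_exp_sgn_pow (m : ℤ) (z : ℂ) :
    Complex.exp (Complex.I * m * z) = Complex.exp (sgn m * z * Complex.I) ^ m.natAbs := by
  rw [← Complex.exp_nat_mul]
  congr 1
  linear_combination (-(Complex.I * z)) * sgn_mul_natAbs m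

theorem exp_sgn_smul_eR_add_eTheta (hm : m ≠ 0) (φ : ℝ) :
    Complex.exp (sgn m * φ * Complex.I) • (eR φ + (sgn m * Complex.I) • eTheta φ) =
      ![1, sgn m * Complex.I] := by
  have hσ : sgn m ^ 2 = 1 := sq_eq_one_iff.mpr (sgn_eq_one_or_neg_one hm)
  have hinv : (Complex.cos φ + sgn m * Complex.I * Complex.sin φ) *
      (Complex.cos φ - sgn m * Complex.I * Complex.sin φ) = 1 := by
    linear_combination Complex.cos_sq_add_sin_sq φ -
      Complex.sin φ ^ 2 * (sgn m ^ 2 * Complex.I_sq - hσ)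
  have hframe : eR φ + (sgn m * Complex.I) • eTheta φ =
      (Complex.cos φ - sgn m * Complex.I * Complex.sin φ) • ![1, sgn m * Complex.I] := by
    simp only [eR, eTheta, smul_cons, smul_empty, cons_add_cons, empty_add_empty, smul_eq_mul,
      Complex.ofReal_cos, Complex.ofReal_sin]
    congr 2
    · ring
    · linear_combination Complex.sin φ * (sgn m ^ 2 * Complex.I_sq - hσ)
  rw [exp_sgn_mul_mul_I hm, hframe, smul_smul, hinv, one_smul]

theorem smul_eR_add_eTheta_eq_signedCoord_pow_smul (hm : m ≠ 0) (p : Plane) :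
    ((‖p‖ : ℂ) ^ (m.natAbs - 1) * Complex.exp (Complex.I * m * polarAngle p)) •
        (eR (polarAngle p) + (sgn m * Complex.I) • eTheta (polarAngle p)) =
      signedCoord m p ^ (m.natAbs - 1) • ![1, sgn m * Complex.I] := by
  rw [signedCoord_eq_norm_mul_exp hm, exp_I_mul_eq_exp_sgn_pow,
    ← exp_sgn_smul_eR_add_eTheta hm (polarAngle p), smul_smul,
    ← pow_sub_one_mul (Int.natAbs_ne_zero.mpr hm) (Complex.exp _), ← mul_assoc, ← mul_pow]

theorem harmonicY_smul_rER (hm : m ≠ 0) (p : Plane) :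
    harmonicY m p • rER p =
      ((‖p‖ : ℂ) ^ (m.natAbs - 1) * Complex.exp (Complex.I * m * polarAngle p) * (‖p‖ : ℂ) ^ 2) •
        eR (polarAngle p) := by
  rw [harmonicY_eq_signedCoord_pow, signedCoord_eq_norm_mul_exp hm, rER_eq_norm_smul_eR, smul_smul,
    exp_I_mul_eq_exp_sgn_pow, mul_pow,
    ← pow_sub_one_mul (Int.natAbs_ne_zero.mpr hm) (‖p‖ : ℂ)]
  congr 1
  ring

theorem weightN_mulVec_liftMode_vAux (hm : m ≠ 0) (j : ℕ) (p : Plane) :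
    weightN p *ᵥ liftMode m (vAux j (m.natAbs - 1)) p =
      ((1 - (‖p‖ : ℂ) ^ 2) * (m.natAbs * shiftedJacobi j 1 m.natAbs (‖p‖ ^ 2)) *
          signedCoord m p ^ (m.natAbs - 1)) • ![1, sgn m * Complex.I] -
        (2 * (j + 1) * shiftedJacobi j 0 (m.natAbs + 1) (‖p‖ ^ 2) * harmonicY m p) • rER p := by
  rw [mul_smul _ (signedCoord m p ^ _), ← smul_eR_add_eTheta_eq_signedCoord_pow_smul hm,
    mul_smul _ (harmonicY m p), harmonicY_smul_rER hm, weightN_mulVec_liftMode]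
  simp only [vAux, cons_val_zero, cons_val_one, sub_add_cancel,
    show (m.natAbs : ℝ) - 1 + 2 = m.natAbs + 1 by ring]
  push_cast
  module

theorem qOne_add_qTwo_succ (n : ℕ) (b : ℝ) :
    qOne (n + 1) b + qTwo (n + 1) b = (-(1 / (n + 1)) : ℝ) • vAux n b := by
  ext t : 1
  simp only [Pi.add_apply, Pi.smul_apply, qTwo]
  push_cast
  module

theorem liftMode_add (m : ℤ) (f g : ℝ → Fin 2 → ℝ) (p : Plane) :
    liftMode m (f + g) p = liftMode m f p + liftMode m g p := by
  simp only [liftMode_eq_smul_eR_add_eTheta, Pi.add_apply, Complex.ofReal_add]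
  module

theorem liftMode_smul (m : ℤ) (c : ℝ) (f : ℝ → Fin 2 → ℝ) (p : Plane) :
    liftMode m (c • f) p = (c : ℂ) • liftMode m f p := by
  simp only [liftMode_eq_smul_eR_add_eTheta, Pi.smul_apply, smul_eq_mul, Complex.ofReal_mul]
  module

theorem neg_smul_nPlus_succ (hm : m ≠ 0) (j : ℕ) (p : Plane) :
    (-((j : ℂ) + 1)) • nPlus m (j + 1) p =
      weightN p *ᵥ liftMode m (vAux j (m.natAbs - 1)) p := by
  have hj : (j : ℂ) + 1 ≠ 0 := Nat.cast_add_one_ne_zero j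
  simp only [nPlus, nOne, nTwo, vNOne, vNTwo, if_neg hm]
  rw [← mulVec_add, ← liftMode_add, qOne_add_qTwo_succ, liftMode_smul, mulVec_smul, smul_smul]
  push_cast
  rw [neg_mul_neg, mul_one_div_cancel hj, one_smul]

theorem nPlus_zero_succ (j : ℕ) (p : Plane) :
    nPlus 0 (j + 1) p = (2 * shiftedJacobi j 0 1 (‖p‖ ^ 2) : ℂ) • rER p := by
  rw [nPlus, if_pos rfl, nOne, vNOne, if_pos rfl, mulVec_smul, weightN_mulVec_rER, smul_smul,
    Nat.add_sub_cancel]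

end Modes

end DiskZernike

open DiskZernike in
theorem theorem6 (m : ℤ) (j : ℕ) :
    Differentiable ℝ (DiskZernike.weightedZernike m j) ∧
    ∀ p : DiskZernike.Plane,
      DiskZernike.gradC (DiskZernike.weightedZernike m j) p
        = (-((j : ℂ) + 1)) • DiskZernike.nPlus m (j + 1) p := by
  refine ⟨differentiable_weightedZernike m j, fun p ↦ ?_⟩
  rw [gradC_weightedZernike]
  rcases eq_or_ne m 0 with rfl | hm
  · simp only [nPlus_zero_succ, harmonicY_eq_signedCoord_pow, Int.natAbs_zero, Nat.cast_zero,
      zero_add, pow_zero]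
    module
  · rw [neg_smul_nPlus_succ hm, weightN_mulVec_liftMode_vAux hm]
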